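/- Let $\Omega$ be a compact metric space, $T:\Omega\to\Omega$ a homeomorphism, $C\in GL(m,\mathbb C)$, and let $V:\Omega\to \mathrm{Her}(m,\mathbb C)$ be a continuous map into the Hermitian $m\times m$ matrices. For $\omega\in\Omega$ let $H_{V,T,\omega}$ be the bounded self-adjoint operator on $\ell^2(\mathbb Z,\mathbb C^m)$ given by $$(H_{V,T,\omega}u)_n = C u_{n+1}+V(T^n\omega)u_n+C^*u_{n-1},\qquad n\in\mathbb Z .$$ For $E\in\mathbb R$ let $$A_E(\omega)=\begin{pmatrix} C^{-1}(E I-V(\omega)) & -C^{-1}C^*\\ I&0\end{pmatrix},$$ with iterates $(A_E)_0=I$, $(A_E)_n(\omega)=A_E(T^{n-1}\omega)\cdots A_E(T\omega)A_E(\omega)$ and $(A_E)_{-n}(\omega)=\big((A_E)_n(T^{-n}\omega)\big)^{-1}$ for $n\ge 1$. The cocycle $(T,A_E)$ is partially hyperbolic if there is a splitting $\mathbb C^{2m}=E^u_{A_E}(\omega)\oplus E^c_{A_E}(\omega)\oplus E^s_{A_E}(\omega)$, $\omega\in\Omega$ (any of the three bundles may be trivial), such that: 1. the splitting is invariant, $A_E(\omega)E^{*}_{A_E}(\omega)=E^{*}_{A_E}(T\omega)$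 for $*\in\{u,c,s\}$; 2. the splitting is dominated: for each of the two pairs $(G,F)=(E^u_{A_E},E^c_{A_E})$ and $(G,F)=(E^c_{A_E},E^s_{A_E})$ there are $n\ge1$ and $\kappa<1$ such that $\|(A_E)_n(\omega)w\|\le\kappa\,\|(A_E)_n(\omega)v\|$ for all $\omega\in\Omega$ and all unit vectors $v\in G(\omega)$, $w\in F(\omega)$; 3. there are $K,c>0$ such that for all $n\ge0$ and $\omega\in\Omega$, $\|(A_E)_n(\omega)v\|\le Ke^{-cn}\|v\|$ for $v\in E^s_{A_E}(\omega)$ and $\|(A_E)_n(\omega)^{-1}v\|\le Ke^{-cn}\|v\|$ for $v\in E^u_{A_E}(T^n\omega)$. Then for every $\omega\in\Omega$ the operator $H_{V,T,\omega}$ is purely absolutely continuous on the set $$\mathcal B_\omega=\Big\{E\in\mathbb R:\ (T,A_E)\text{ is partially hyperbolic, with a splitting for which } \sup_{n\in\mathbb Z}\big\|(A_E)_n(\omega)|_{E^c_{A_E}(\omega)}\big\|<\infty\Big\};$$ that is, for every $\psi\in\ell^2(\mathbb Z,\mathbb C^m)$ the restriction to $\mathcal B_\omega$ of the spectral measure of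 $H_{V,T,\omega}$ at $\psi$ is absolutely continuous with respect to Lebesgue measure. -/

import Mathlib

open scoped Matrix

noncomputable section

namespace StripSchrodinger

/-! ### The Hilbert space `ℓ²(ℤ, ℂᵐ)` and the strip operator -/

/-- The Hilbert space `ℓ²(ℤ, ℂᵐ)`, with `ℂᵐ` carrying its Euclidean norm. -/
abbrev StripSpace (m : ℕ) : Type :=
  lp (fun _ : ℤ => EuclideanSpace ℂ (Fin m)) 2

/-- The space `Her(m, ℂ)` of Hermitian `m × m` matrices. -/
abbrev Her (m : ℕ) : Type := selfAdjoint (Matrix (Fin m) (Fin m) ℂ)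

theorem two_toReal_pos : 0 < (2 : ENNReal).toReal := by norm_num

theorem hopping_aux {m : ℕ} (a : ℤ → EuclideanSpace ℂ (Fin m) →L[ℂ] EuclideanSpace ℂ (Fin m))
    (K : ℝ) (ha : ∀ n, ‖a n‖ ≤ K) (k : ℤ) (u : StripSpace m) :
    Summable (fun n : ℤ => ‖a n (u (n + k))‖ ^ (2 : ENNReal).toReal) ∧
      ∑' n : ℤ, ‖a n (u (n + k))‖ ^ (2 : ENNReal).toReal
        ≤ (K * ‖u‖) ^ (2 : ENNReal).toReal := by
  have hK : 0 ≤ K := (norm_nonneg _).trans (ha 0)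
  have hu : Summable fun n : ℤ => ‖u n‖ ^ (2 : ENNReal).toReal :=
    (lp.memℓp u).summable two_toReal_pos
  have hu' : Summable fun n : ℤ => ‖u (n + k)‖ ^ (2 : ENNReal).toReal :=
    hu.comp_injective (add_left_injective k)
  have hle : ∀ n : ℤ, ‖a n (u (n + k))‖ ^ (2 : ENNReal).toReal
      ≤ K ^ (2 : ENNReal).toReal * ‖u (n + k)‖ ^ (2 : ENNReal).toReal := fun n => by
    rw [← Real.mul_rpow hK (norm_nonneg _)]
    exact Real.rpow_le_rpow (norm_nonneg _)
      (((a n).le_opNorm _).trans (mul_le_mul_of_nonneg_right (ha n) (norm_nonneg _)))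
      two_toReal_pos.le
  have hs : Summable (fun n : ℤ => ‖a n (u (n + k))‖ ^ (2 : ENNReal).toReal) :=
    Summable.of_nonneg_of_le (fun n => Real.rpow_nonneg (norm_nonneg _) _) hle
      (hu'.mul_left _)
  refine ⟨hs, (hs.tsum_le_tsum hle (hu'.mul_left _)).trans_eq ?_⟩
  rw [tsum_mul_left, Real.mul_rpow hK (norm_nonneg _), lp.norm_rpow_eq_tsum two_toReal_pos u]
  congr 1
  exact (Equiv.addRight k).tsum_eq (fun n : ℤ => ‖u n‖ ^ (2 : ENNReal).toReal)

/-- The bounded operator `(u_n)_n ↦ (a_n u_{n+k})_n` on `ℓ²(ℤ, ℂᵐ)`, for a bounded sequence of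
matrices `a_n`. -/
def hopping {m : ℕ} (a : ℤ → EuclideanSpace ℂ (Fin m) →L[ℂ] EuclideanSpace ℂ (Fin m))
    (K : ℝ) (ha : ∀ n, ‖a n‖ ≤ K) (k : ℤ) : StripSpace m →L[ℂ] StripSpace m :=
  LinearMap.mkContinuous
    { toFun := fun u => ⟨fun n => a n (u (n + k)),
        (memℓp_gen_iff two_toReal_pos).2 (hopping_aux a K ha k u).1⟩
      map_add' := fun u v => by ext1; funext n; simp; rfl
      map_smul' := fun c u => by ext1; funext n; simp }
    K
    (fun u => lp.norm_le_of_tsum_le two_toReal_pos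
      (mul_nonneg ((norm_nonneg _).trans (ha 0)) (norm_nonneg _)) (hopping_aux a K ha k u).2)

@[simp] theorem hopping_apply {m : ℕ}
    (a : ℤ → EuclideanSpace ℂ (Fin m) →L[ℂ] EuclideanSpace ℂ (Fin m))
    (K : ℝ) (ha : ∀ n, ‖a n‖ ≤ K) (k : ℤ) (u : StripSpace m) (n : ℤ) :
    hopping a K ha k u n = a n (u (n + k)) := rfl

section Operator

variable {Ω : Type*} [MetricSpace Ω] [CompactSpace Ω] {m : ℕ}

/-- A Hermitian matrix-valued potential on a compact space is bounded in operator norm. -/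
theorem exists_potential_bound (V : C(Ω, Her m)) :
    ∃ K : ℝ, ∀ x : Ω,
      ‖Matrix.toEuclideanCLM (n := Fin m) (𝕜 := ℂ) (V x : Matrix (Fin m) (Fin m) ℂ)‖ ≤ K := by
  have hL : Continuous (fun M : Matrix (Fin m) (Fin m) ℂ =>
      Matrix.toEuclideanCLM (n := Fin m) (𝕜 := ℂ) M) :=
    LinearMap.continuous_of_finiteDimensional
      ((Matrix.toEuclideanCLM (n := Fin m) (𝕜 := ℂ)).toAlgEquiv.toLinearMap)
  have hc : Continuous fun x : Ω =>
      ‖Matrix.toEuclideanCLM (n := Fin m) (𝕜 := ℂ) (V x : Matrix (Fin m) (Fin m) ℂ)‖ :=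
    (hL.comp (continuous_subtype_val.comp V.continuous)).norm
  obtain ⟨K, hK⟩ := (isCompact_range hc).bddAbove
  exact ⟨K, fun x => hK ⟨x, rfl⟩⟩

/-- The strip Schrödinger operator
`(H_{V,T,ω} u)_n = C u_{n+1} + V(T^n ω) u_n + C* u_{n-1}` on `ℓ²(ℤ, ℂᵐ)`. -/
def stripOperator (T : Ω ≃ₜ Ω) (C : GL (Fin m) ℂ) (V : C(Ω, Her m)) (ω : Ω) :
    StripSpace m →L[ℂ] StripSpace m :=
  hopping (fun _ => Matrix.toEuclideanCLM (n := Fin m) (𝕜 := ℂ) (C : Matrix (Fin m) (Fin m) ℂ))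
      _ (fun _ => le_rfl) 1
    + hopping (fun n => Matrix.toEuclideanCLM (n := Fin m) (𝕜 := ℂ)
        (V ((T ^ n) ω) : Matrix (Fin m) (Fin m) ℂ))
      _ (fun _ => (exists_potential_bound V).choose_spec _) 0
    + hopping (fun _ => Matrix.toEuclideanCLM (n := Fin m) (𝕜 := ℂ)
        (C : Matrix (Fin m) (Fin m) ℂ)ᴴ)
      _ (fun _ => le_rfl) (-1)

theorem stripOperator_apply (T : Ω ≃ₜ Ω) (C : GL (Fin m) ℂ) (V : C(Ω, Her m)) (ω : Ω)
    (u : StripSpace m) (n : ℤ) :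
    stripOperator T C V ω u n =
      Matrix.toEuclideanCLM (n := Fin m) (𝕜 := ℂ) (C : Matrix (Fin m) (Fin m) ℂ) (u (n + 1))
      + Matrix.toEuclideanCLM (n := Fin m) (𝕜 := ℂ)
          (V ((T ^ n) ω) : Matrix (Fin m) (Fin m) ℂ) (u n)
      + Matrix.toEuclideanCLM (n := Fin m) (𝕜 := ℂ)
          (C : Matrix (Fin m) (Fin m) ℂ)ᴴ (u (n - 1)) := by
  simp [stripOperator, sub_eq_add_neg]

theorem inner_toEuclideanCLM_conjTranspose (M : Matrix (Fin m) (Fin m) ℂ)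
    (x y : EuclideanSpace ℂ (Fin m)) :
    inner ℂ (Matrix.toEuclideanCLM (n := Fin m) (𝕜 := ℂ) M x) y =
      inner ℂ x (Matrix.toEuclideanCLM (n := Fin m) (𝕜 := ℂ) Mᴴ y) := by
  have h : Matrix.toEuclideanCLM (n := Fin m) (𝕜 := ℂ) Mᴴ =
      ContinuousLinearMap.adjoint (Matrix.toEuclideanCLM (n := Fin m) (𝕜 := ℂ) M) := by
    rw [← ContinuousLinearMap.star_eq_adjoint, ← map_star]
    rfl
  rw [h, ContinuousLinearMap.adjoint_inner_right]

theorem inner_hopping {a b : ℤ → EuclideanSpace ℂ (Fin m) →L[ℂ] EuclideanSpace ℂ (Fin m)}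
    {K L : ℝ} (ha : ∀ n, ‖a n‖ ≤ K) (hb : ∀ n, ‖b n‖ ≤ L) (k l : ℤ) (hkl : l = -k)
    (hab : ∀ n x y, inner ℂ (a n x) y = inner ℂ x (b (n + k) y)) (u v : StripSpace m) :
    inner ℂ (hopping a K ha k u) v = inner ℂ u (hopping b L hb l v) := by
  subst hkl
  rw [lp.inner_eq_tsum, lp.inner_eq_tsum,
    ← (Equiv.addRight k).tsum_eq (fun n : ℤ => inner ℂ (u n) (hopping b L hb (-k) v n))]
  refine tsum_congr fun n => ?_
  simp [hab]

/-- The strip operator is self-adjoint. -/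
theorem isSelfAdjoint_stripOperator (T : Ω ≃ₜ Ω) (C : GL (Fin m) ℂ) (V : C(Ω, Her m)) (ω : Ω) :
    IsSelfAdjoint (stripOperator T C V ω) := by
  rw [ContinuousLinearMap.isSelfAdjoint_iff_isSymmetric]
  intro u v
  have h1 := inner_toEuclideanCLM_conjTranspose (C : Matrix (Fin m) (Fin m) ℂ)
  have h2 := inner_toEuclideanCLM_conjTranspose (C : Matrix (Fin m) (Fin m) ℂ)ᴴ
  have h3 := fun n : ℤ =>
    inner_toEuclideanCLM_conjTranspose (V ((T ^ n) ω) : Matrix (Fin m) (Fin m) ℂ)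
  have h4 : ∀ n : ℤ, (V ((T ^ n) ω) : Matrix (Fin m) (Fin m) ℂ)ᴴ = V ((T ^ n) ω) :=
    fun n => (V ((T ^ n) ω)).2
  rw [Matrix.conjTranspose_conjTranspose] at h2
  simp only [h4] at h3
  simp only [stripOperator, ContinuousLinearMap.coe_coe, add_apply,
    inner_add_left, inner_add_right]
  rw [inner_hopping (fun _ => le_rfl) (fun _ => le_rfl) 1 (-1) rfl (fun _ => h1),
    inner_hopping (fun _ => le_rfl) (fun _ => le_rfl) (-1) 1 (by norm_num) (fun _ => h2),
    inner_hopping (fun _ => (exists_potential_bound V).choose_spec _)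
      (fun _ => (exists_potential_bound V).choose_spec _) 0 0 (by norm_num)
      (fun n => by simpa using h3 n)]
  ring

end Operator

/-! ### Spectral measures -/

section SpectralMeasure

variable {𝓗 : Type*} [NormedAddCommGroup 𝓗] [InnerProductSpace ℂ 𝓗] [CompleteSpace 𝓗]

/-- The positive linear functional `f ↦ ⟨ψ, f(H) ψ⟩` on `C_c(ℝ, ℝ)`, where `f(H)` is given by the
continuous functional calculus of the self-adjoint operator `H`. -/
def spectralFunctional (H : 𝓗 →L[ℂ] 𝓗) (_hH : IsSelfAdjoint H) (ψ : 𝓗) :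
    CompactlySupportedContinuousMap ℝ ℝ →ₚ[ℝ] ℝ :=
  PositiveLinearMap.mk₀
    { toFun := fun f => (inner ℂ ψ (cfc (fun x : ℝ => f x) H ψ)).re
      map_add' := fun f g => by
        have h : cfc (fun x : ℝ => (f + g) x) H
            = cfc (fun x : ℝ => f x) H + cfc (fun x : ℝ => g x) H :=
          cfc_add (R := ℝ) H (fun x => f x) (fun x => g x)
            f.continuous.continuousOn g.continuous.continuousOn
        rw [h, add_apply, inner_add_right, Complex.add_re]
      map_smul' := fun c f => by
        have h : cfc (fun x : ℝ => (c • f) x) H = c • cfc (fun x : ℝ => f x) H :=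
          cfc_smul (R := ℝ) c (fun x => f x) H f.continuous.continuousOn
        rw [h, smul_apply, inner_smul_right_eq_smul]
        simp }
    (fun f hf => by
      have h : 0 ≤ cfc (fun x : ℝ => f x) H := cfc_nonneg (fun x _ => hf x)
      have h' := (ContinuousLinearMap.nonneg_iff_isPositive _).1 h
      exact h'.re_inner_nonneg_right ψ)

/-- The spectral measure `μ_ψ` of the bounded self-adjoint operator `H` at the vector `ψ`: the Borel
measure on `ℝ` with `∫ f dμ_ψ = ⟨ψ, f(H) ψ⟩` for all `f ∈ C_c(ℝ, ℝ)`. -/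
def spectralMeasure (H : 𝓗 →L[ℂ] 𝓗) (hH : IsSelfAdjoint H) (ψ : 𝓗) : MeasureTheory.Measure ℝ :=
  RealRMK.rieszMeasure (spectralFunctional H hH ψ)

theorem integral_spectralMeasure (H : 𝓗 →L[ℂ] 𝓗) (hH : IsSelfAdjoint H) (ψ : 𝓗)
    (f : CompactlySupportedContinuousMap ℝ ℝ) :
    ∫ x, f x ∂(spectralMeasure H hH ψ) = (inner ℂ ψ (cfc (fun x : ℝ => f x) H ψ)).re :=
  RealRMK.integral_rieszMeasure _ f

/-- The self-adjoint operator `H` is purely absolutely continuous on the set `S` of energies: for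
every vector `ψ`, the spectral measure `μ_ψ` restricted to `S` is absolutely continuous with respect
to Lebesgue measure. -/
def IsPurelyAbsolutelyContinuousOn (H : 𝓗 →L[ℂ] 𝓗) (hH : IsSelfAdjoint H) (S : Set ℝ) : Prop :=
  ∀ ψ : 𝓗, ((spectralMeasure H hH ψ).restrict S).AbsolutelyContinuous MeasureTheory.volume

end SpectralMeasure

/-! ### Cocycles and partial hyperbolicity -/

section Cocycle

variable {Ω : Type*} [TopologicalSpace Ω]

/-- Forward iterates: `A_n(ω) = A(T^{n-1} ω) ⋯ A(T ω) A(ω)` for `n ≥ 0`. -/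
def cocycleIterNat {ι : Type*} [Fintype ι] [DecidableEq ι] (T : Ω ≃ₜ Ω) (A : Ω → Matrix ι ι ℂ) :
    ℕ → Ω → Matrix ι ι ℂ
  | 0, _ => 1
  | n + 1, ω => A ((T ^ n) ω) * cocycleIterNat T A n ω

/-- The iterates `A_n(ω)`, `n ∈ ℤ`, of the cocycle `(T, A)`; for `n ≥ 1`,
`A_{-n}(ω) = A_n(T^{-n} ω)⁻¹`. -/
def cocycleIter {ι : Type*} [Fintype ι] [DecidableEq ι] (T : Ω ≃ₜ Ω) (A : Ω → Matrix ι ι ℂ) :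
    ℤ → Ω → Matrix ι ι ℂ
  | Int.ofNat n, ω => cocycleIterNat T A n ω
  | Int.negSucc n, ω => (cocycleIterNat T A (n + 1) ((T ^ (Int.negSucc n)) ω))⁻¹

/-- The action of a square matrix on `ℂ^ι` with the Euclidean norm. -/
abbrev act {ι : Type*} [Fintype ι] [DecidableEq ι] (M : Matrix ι ι ℂ) :
    EuclideanSpace ℂ ι →L[ℂ] EuclideanSpace ℂ ι :=
  Matrix.toEuclideanCLM (n := ι) (𝕜 := ℂ) M

/-- The bundle `F` is dominated by the bundle `G`: after some fixed number `n ≥ 1` of iterates,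
every unit vector of `G(ω)` is stretched more than every unit vector of `F(ω)`, by a factor that is
uniform in `ω`. -/
def IsDominatedBy {ι : Type*} [Fintype ι] [DecidableEq ι] (T : Ω ≃ₜ Ω) (A : Ω → Matrix ι ι ℂ)
    (F G : Ω → Submodule ℂ (EuclideanSpace ℂ ι)) : Prop :=
  ∃ n : ℕ, 1 ≤ n ∧ ∃ κ : ℝ, κ < 1 ∧ ∀ ω, ∀ w ∈ F ω, ∀ v ∈ G ω, ‖w‖ = 1 → ‖v‖ = 1 →
    ‖act (cocycleIter T A n ω) w‖ ≤ κ * ‖act (cocycleIter T A n ω) v‖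

/-- `ℂ^ι = E^u(ω) ⊕ E^c(ω) ⊕ E^s(ω)` is a partially hyperbolic splitting for `(T, A)`: it is
`A`-invariant and dominated, `A` uniformly expands `E^u` and uniformly contracts `E^s`. Each of the
three bundles may be trivial. -/
structure IsPartiallyHyperbolicSplitting {ι : Type*} [Fintype ι] [DecidableEq ι] (T : Ω ≃ₜ Ω)
    (A : Ω → Matrix ι ι ℂ) (Eu Ec Es : Ω → Submodule ℂ (EuclideanSpace ℂ ι)) : Prop where
  isInternal : ∀ ω, DirectSum.IsInternal ![Eu ω, Ec ω, Es ω]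
  map_unstable : ∀ ω, (Eu ω).map (act (A ω)).toLinearMap = Eu (T ω)
  map_center : ∀ ω, (Ec ω).map (act (A ω)).toLinearMap = Ec (T ω)
  map_stable : ∀ ω, (Es ω).map (act (A ω)).toLinearMap = Es (T ω)
  center_dominatedBy_unstable : IsDominatedBy T A Ec Eu
  stable_dominatedBy_center : IsDominatedBy T A Es Ec
  uniform : ∃ K > (0 : ℝ), ∃ c > (0 : ℝ), ∀ (n : ℕ) (ω : Ω),
    (∀ v ∈ Es ω, ‖act (cocycleIter T A n ω) v‖ ≤ K * Real.exp (-c * n) * ‖v‖) ∧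
    (∀ v ∈ Eu ((T ^ n) ω), ‖act (cocycleIter T A n ω)⁻¹ v‖ ≤ K * Real.exp (-c * n) * ‖v‖)

end Cocycle

/-! ### The Schrödinger cocycle and the set of energies with bounded center -/

section SchrodingerCocycle

variable {Ω : Type*} [MetricSpace Ω] [CompactSpace Ω] {m : ℕ}

/-- The Schrödinger cocycle `A_E(ω) = [[C⁻¹ (E I - V(ω)), -C⁻¹ C*], [I, 0]]`. -/
def schrodingerCocycle (C : GL (Fin m) ℂ) (V : C(Ω, Her m)) (E : ℝ) (ω : Ω) :
    Matrix (Fin m ⊕ Fin m) (Fin m ⊕ Fin m) ℂ :=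
  Matrix.fromBlocks
    ((C : Matrix (Fin m) (Fin m) ℂ)⁻¹ *
      ((E : ℂ) • (1 : Matrix (Fin m) (Fin m) ℂ) - (V ω : Matrix (Fin m) (Fin m) ℂ)))
    (-((C : Matrix (Fin m) (Fin m) ℂ)⁻¹ * (C : Matrix (Fin m) (Fin m) ℂ)ᴴ)) 1 0

/-- The set `𝓑_ω` of energies `E` at which `(T, A_E)` is partially hyperbolic, with a splitting
`E^u ⊕ E^c ⊕ E^s` such that `sup_{n ∈ ℤ} ‖(A_E)_n(ω)|_{E^c(ω)}‖ < ∞`. -/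
def centerBoundedEnergies (T : Ω ≃ₜ Ω) (C : GL (Fin m) ℂ) (V : C(Ω, Her m)) (ω : Ω) : Set ℝ :=
  {E | ∃ Eu Ec Es : Ω → Submodule ℂ (EuclideanSpace ℂ (Fin m ⊕ Fin m)),
    IsPartiallyHyperbolicSplitting T (schrodingerCocycle C V E) Eu Ec Es ∧
    BddAbove (Set.range fun n : ℤ =>
      ‖(act (cocycleIter T (schrodingerCocycle C V E) n ω)).comp (Ec ω).subtypeL‖)}

end SchrodingerCocycle

end StripSchrodinger

end

/-! For a bounded self-adjoint `H`, if `ε‖u‖²` with `u = (H - E - iε)⁻¹ψ` stays bounded as `ε → 0`,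
the spectral measure at `ψ` has finite upper density at `E` (`spectralMeasure_closedBall_le`).
Covering then shows that a null set of such energies is not charged
(`measure_eq_zero_of_upperDensity_lt_top`). Vectors not charging a given set are closed under sums
and limits, so `ψ = δ_k ⊗ w` suffices (`isPurelyAbsolutelyContinuousOn_of_resolvent_bound`).

For such `ψ`, `ε‖u‖² = Im ⟨w, u_k⟩`, and `⟨w, u_k⟩` is the Wronskian at `k` of `u` with a
generalized eigenfunction `φ` vanishing at `k` (`exists_wronskian_eq_inner`). Split the initial
vector of `φ` along `E^u ⊕ E^c ⊕ E^s`: each component is bounded on at least one half-line. There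
its Wronskian with `u` is dominated by local values of `‖u‖` and, away from `k`, drifts only by
`O(ε‖u_n‖)` per site. Averaging over about `1/ε` sites (`norm_sq_le_of_slowly_varying`) bounds its
square at `k` by `K(1 + ε‖u‖²)`. Hence `g = ε‖u‖²` satisfies `g² ≤ K(1 + g)` with a new `K`
independent of `ε`, so `g` is bounded. -/

noncomputable section

namespace StripSchrodinger

open MeasureTheory Set Filter Topology
open scoped Matrix ENNReal

/-! ### Resolvents and spectral measures of a bounded self-adjoint operator -/

section Spectral

variable {𝓗 : Type*} [NormedAddCommGroup 𝓗] [InnerProductSpace ℂ 𝓗] [CompleteSpace 𝓗]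

/-- The quadratic form `⟨ψ, f(H) ψ⟩` of the functional calculus is bounded by `b ‖u‖²` when
`ψ = (H - z) u` and `|x - z|² f(x) ≤ b` on the real line. -/
theorem re_inner_cfc_le_of_resolvent {H : 𝓗 →L[ℂ] 𝓗} (hH : IsSelfAdjoint H) {f : ℝ → ℝ}
    (hf : Continuous f) {E ε b : ℝ} (hfb : ∀ x, ((x - E) ^ 2 + ε ^ 2) * f x ≤ b)
    {ψ u : 𝓗} (hu : H u - ((E : ℂ) + ε * Complex.I) • u = ψ) :
    (inner ℂ ψ (cfc f H ψ)).re ≤ b * ‖u‖ ^ 2 := by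
  set F := cfc f H with hF
  set D := cfc (fun x : ℝ => x - E) H with hD
  have hDu : H u = D u + (E : ℂ) • u := by
    rw [hD, cfc_sub (fun x : ℝ => x) (fun _ => E) H, cfc_id' ℝ H, cfc_const E H]
    simp [Algebra.algebraMap_eq_smul_one]
  have hDs : IsSelfAdjoint D := cfc_predicate _ _
  have hcomm : D * F = F * D := cfc_commute_cfc _ _ _
  -- With `D = H - E` and `F = f(H)`, the scalar bound becomes `(D² + ε²)F ≤ b`. The grouping of the
  -- factors lets it split as `D(DF)`.
  have hpos : 0 ≤ cfc (fun x : ℝ => b - ((x - E) * ((x - E) * f x) + ε ^ 2 * f x)) H :=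
    cfc_nonneg fun x _ => by linarith [hfb x]
  have heq : cfc (fun x : ℝ => b - ((x - E) * ((x - E) * f x) + ε ^ 2 * f x)) H =
      algebraMap ℝ _ b - (D * (D * F) + (ε ^ 2 : ℝ) • F) := by
    rw [cfc_sub (fun _ : ℝ => b) (fun x : ℝ => (x - E) * ((x - E) * f x) + ε ^ 2 * f x) H,
      cfc_const b H, cfc_add (R := ℝ) H (fun x : ℝ => (x - E) * ((x - E) * f x))
      (fun x => ε ^ 2 * f x), cfc_mul (fun x : ℝ => x - E) (fun x : ℝ => (x - E) * f x) H,
      cfc_mul (fun x : ℝ => x - E) f H, cfc_const_mul (ε ^ 2) f H]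
  have hu0 := ((ContinuousLinearMap.nonneg_iff_isPositive _).1 hpos).re_inner_nonneg_right u
  rw [heq, hcomm, Algebra.algebraMap_eq_smul_one] at hu0
  simp only [sub_apply, add_apply, smul_apply, mul_apply_eq_comp, one_apply_eq_self,
    inner_sub_right, inner_add_right, inner_smul_right_eq_smul, inner_self_eq_norm_sq_to_K] at hu0
  have hsym : ∀ x y, inner ℂ (D x) y = inner ℂ x (D y) := hDs.isSymmetric
  have hFD : F (D u) = D (F u) := congrArg (fun G : 𝓗 →L[ℂ] 𝓗 => G u) hcomm.symm
  have hψ : ψ = D u - (ε * Complex.I) • u := by rw [← hu, hDu, add_smul]; abel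
  -- Here `ψ = (D - iε)u`; the cross terms `±iε⟨u, DFu⟩` cancel because `D` is symmetric and
  -- commutes with `F`.
  have hval : inner ℂ ψ (F ψ) = inner ℂ u (D (F (D u))) + (ε ^ 2 : ℝ) • inner ℂ u (F u) := by
    rw [hψ]
    simp only [map_sub, map_smul, inner_sub_left, inner_sub_right, inner_smul_left,
      inner_smul_right, hsym, hFD]
    simp
    ring_nf
    rw [Complex.I_sq]; ring
  rw [hval]
  simp [← Complex.ofReal_pow] at hu0 ⊢
  linarith

/-- A real energy `E` shifted by `iε`, `ε > 0`, is in the resolvent set of a self-adjoint `H`. -/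
theorem exists_resolvent_eq {H : 𝓗 →L[ℂ] 𝓗} (hH : IsSelfAdjoint H) (E : ℝ) {ε : ℝ} (hε : 0 < ε)
    (ψ : 𝓗) : ∃ u : 𝓗, H u - ((E : ℂ) + ε * Complex.I) • u = ψ := by
  have hz : ((E : ℂ) + ε * Complex.I) ∉ spectrum ℂ H := fun h => by
    have := hH.mem_spectrum_eq_re h
    have := congrArg Complex.im this
    simp at this
    exact hε.ne' this
  rw [spectrum.notMem_iff] at hz
  obtain ⟨a, ha⟩ := hz
  refine ⟨-((↑a⁻¹ : 𝓗 →L[ℂ] 𝓗) ψ), ?_⟩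
  have h1 : ((a : 𝓗 →L[ℂ] 𝓗) * (↑a⁻¹ : 𝓗 →L[ℂ] 𝓗)) ψ = ψ := by
    rw [Units.mul_inv]; rfl
  rw [ha] at h1
  simp only [mul_apply_eq_comp, sub_apply, Algebra.algebraMap_eq_smul_one,
    smul_apply, one_apply_eq_self] at h1
  rw [map_neg, smul_neg]
  rw [← sub_eq_zero] at h1 ⊢
  rw [← h1]; abel

/-- `⟨Hu, u⟩` is real, so only the shift contributes; conjugate linearity in the first slot makes
the sign positive. This converts control of one Green function entry into control of the whole `ℓ²`
norm. -/
theorem im_inner_resolvent {H : 𝓗 →L[ℂ] 𝓗} (hH : IsSelfAdjoint H) {E ε : ℝ} {ψ u : 𝓗}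
    (hu : H u - ((E : ℂ) + ε * Complex.I) • u = ψ) :
    (inner ℂ ψ u).im = ε * ‖u‖ ^ 2 := by
  have h := hH.isSymmetric
  have him : (inner ℂ (H u) u).im = 0 := by
    have := h.im_inner_apply_self u
    simpa using this
  rw [← hu, inner_sub_left, inner_smul_left, inner_self_eq_norm_sq_to_K, Complex.sub_im, him]
  simp [← Complex.ofReal_pow]

theorem exists_bump (K : Set ℝ) (hK : IsCompact K) (U : Set ℝ) (hU : IsOpen U) (hKU : K ⊆ U) :
    ∃ f : CompactlySupportedContinuousMap ℝ ℝ, (∀ x ∈ K, f x = 1) ∧ (∀ x, x ∉ U → f x = 0) ∧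
      ∀ x, 0 ≤ f x ∧ f x ≤ 1 := by
  obtain ⟨f, h1, h0, hc, h01⟩ := exists_continuous_one_zero_of_isCompact hK
    hU.isClosed_compl (disjoint_compl_right_iff_subset.2 hKU)
  exact ⟨⟨f, hc⟩, fun x hx => h1 hx, fun x hx => h0 hx, fun x => h01 x⟩

theorem spectralMeasure_le_of_eq_one {H : 𝓗 →L[ℂ] 𝓗} (hH : IsSelfAdjoint H) (ψ : 𝓗)
    {f : CompactlySupportedContinuousMap ℝ ℝ} (hf : ∀ x, 0 ≤ f x) {K : Set ℝ} (hK : IsCompact K)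
    (hfK : ∀ x ∈ K, f x = 1) :
    spectralMeasure H hH ψ K ≤ ENNReal.ofReal (inner ℂ ψ (cfc (fun x : ℝ => f x) H ψ)).re :=
  RealRMK.rieszMeasure_le_of_eq_one (spectralFunctional H hH ψ) hf hK hfK

/-- Test with bumps equal to one on growing balls: `‖f(H)‖ ≤ 1` for each of them. -/
theorem spectralMeasure_univ_le {H : 𝓗 →L[ℂ] 𝓗} (hH : IsSelfAdjoint H) (ψ : 𝓗) :
    spectralMeasure H hH ψ univ ≤ ENNReal.ofReal (‖ψ‖ ^ 2) := by
  have hb : ∀ n : ℕ, spectralMeasure H hH ψ (Metric.closedBall 0 n) ≤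
      ENNReal.ofReal (‖ψ‖ ^ 2) := fun n => by
    obtain ⟨f, h1, -, h01⟩ := exists_bump (Metric.closedBall 0 n) (isCompact_closedBall _ _) univ
      isOpen_univ (subset_univ _)
    refine (spectralMeasure_le_of_eq_one hH ψ (fun x => (h01 x).1) (isCompact_closedBall _ _)
      h1).trans (ENNReal.ofReal_le_ofReal ?_)
    have hn : ‖cfc (fun x : ℝ => f x) H‖ ≤ 1 := norm_cfc_le zero_le_one fun x _ => by
      rw [Real.norm_eq_abs, abs_of_nonneg (h01 x).1]; exact (h01 x).2
    calc (inner ℂ ψ (cfc (fun x : ℝ => f x) H ψ)).re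
        ≤ ‖inner ℂ ψ (cfc (fun x : ℝ => f x) H ψ)‖ := Complex.re_le_norm _
      _ ≤ ‖ψ‖ * (1 * ‖ψ‖) := (norm_inner_le_norm _ _).trans
          (mul_le_mul_of_nonneg_left (ContinuousLinearMap.le_of_opNorm_le _ hn _) (norm_nonneg _))
      _ = ‖ψ‖ ^ 2 := by ring
  have ht := tendsto_measure_iUnion_atTop (μ := spectralMeasure H hH ψ)
    (s := fun n : ℕ => Metric.closedBall (0 : ℝ) n)
    (fun i j hij => Metric.closedBall_subset_closedBall (by exact_mod_cast hij))
  rw [Metric.iUnion_closedBall_nat] at ht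
  exact le_of_tendsto' ht hb

instance isFiniteMeasure_spectralMeasure (H : 𝓗 →L[ℂ] 𝓗) (hH : IsSelfAdjoint H) (ψ : 𝓗) :
    IsFiniteMeasure (spectralMeasure H hH ψ) :=
  ⟨(spectralMeasure_univ_le hH ψ).trans_lt ENNReal.ofReal_lt_top⟩

/-- The parallelogram law for spectral measures. -/
theorem spectralMeasure_add_add_sub {H : 𝓗 →L[ℂ] 𝓗} (hH : IsSelfAdjoint H) (φ ψ : 𝓗) :
    spectralMeasure H hH (φ + ψ) + spectralMeasure H hH (φ - ψ) =
      (2 : ℝ≥0∞) • (spectralMeasure H hH φ + spectralMeasure H hH ψ) := by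
  have : IsFiniteMeasure ((2 : ℝ≥0∞) • (spectralMeasure H hH φ + spectralMeasure H hH ψ)) :=
    Measure.smul_finite _ (by simp)
  refine Measure.ext_of_integral_eq_on_compactlySupported fun f => ?_
  have hi : ∀ χ : 𝓗, Integrable (fun x => f x) (spectralMeasure H hH χ) := fun χ =>
    f.continuous.integrable_of_hasCompactSupport f.hasCompactSupport
  rw [integral_add_measure (hi _) (hi _), integral_smul_measure,
    integral_add_measure (hi _) (hi _)]
  simp only [integral_spectralMeasure, map_add, map_sub, inner_add_left, inner_add_right,
    inner_sub_left, inner_sub_right, Complex.add_re, Complex.sub_re]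
  simp
  ring

/-- Drop the nonnegative term at `φ - ψ` from the parallelogram law. This replaces a triangle
inequality in the sum and limit arguments. -/
theorem spectralMeasure_add_le {H : 𝓗 →L[ℂ] 𝓗} (hH : IsSelfAdjoint H) (φ ψ : 𝓗) (A : Set ℝ) :
    spectralMeasure H hH (φ + ψ) A ≤
      2 * (spectralMeasure H hH φ A + spectralMeasure H hH ψ A) := by
  have h := congrArg (fun ν : Measure ℝ => ν A) (spectralMeasure_add_add_sub hH φ ψ)
  simp only [Measure.add_apply, Measure.smul_apply, smul_eq_mul] at h
  exact h ▸ le_self_add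

/-- The vectors whose spectral measure does not charge `A` form a closed set. -/
theorem isClosed_spectralMeasure_eq_zero {H : 𝓗 →L[ℂ] 𝓗} (hH : IsSelfAdjoint H) (A : Set ℝ) :
    IsClosed {ψ : 𝓗 | spectralMeasure H hH ψ A = 0} := by
  refine isClosed_of_closure_subset fun ψ hψ => ?_
  obtain ⟨s, hs, hlim⟩ := mem_closure_iff_seq_limit.1 hψ
  have hle : ∀ n, spectralMeasure H hH ψ A ≤ 2 * ENNReal.ofReal (‖ψ - s n‖ ^ 2) := fun n => by
    have h := spectralMeasure_add_le hH (s n) (ψ - s n) A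
    rw [add_sub_cancel, show spectralMeasure H hH (s n) A = 0 from hs n, zero_add] at h
    exact h.trans (mul_le_mul_right ((measure_mono (subset_univ _)).trans
      (spectralMeasure_univ_le hH _)) 2)
  have h0 : Tendsto (fun n => 2 * ENNReal.ofReal (‖ψ - s n‖ ^ 2)) atTop (𝓝 (2 * 0)) := by
    refine ENNReal.Tendsto.const_mul ?_ (Or.inr (by simp))
    rw [← ENNReal.ofReal_zero]
    refine ENNReal.tendsto_ofReal ?_
    have := ((tendsto_const_nhds (x := ψ)).sub hlim).norm.pow 2
    simpa using this
  rw [mul_zero] at h0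
  exact nonpos_iff_eq_zero.1 (ge_of_tendsto' h0 hle)

/-- A bound `ε ‖(H - E - iε)⁻¹ ψ‖² ≤ b` bounds the spectral measure of the ball of radius `ε / 2`
around `E`. -/
theorem spectralMeasure_closedBall_le {H : 𝓗 →L[ℂ] 𝓗} (hH : IsSelfAdjoint H) {E ε b : ℝ}
    (hε : 0 < ε) {ψ u : 𝓗} (hu : H u - ((E : ℂ) + ε * Complex.I) • u = ψ)
    (hb : ε * ‖u‖ ^ 2 ≤ b) :
    spectralMeasure H hH ψ (Metric.closedBall E (ε / 2)) ≤ ENNReal.ofReal (2 * ε * b) := by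
  obtain ⟨f, h1, h0, h01⟩ := exists_bump (Metric.closedBall E (ε / 2)) (isCompact_closedBall _ _)
    (Metric.ball E ε) Metric.isOpen_ball (Metric.closedBall_subset_ball (half_lt_self hε))
  refine (spectralMeasure_le_of_eq_one hH ψ (fun x => (h01 x).1) (isCompact_closedBall _ _)
      h1).trans (ENNReal.ofReal_le_ofReal ?_)
  -- Where the bump is nonzero, `|x - E| < ε`, hence `(x - E)² + ε² ≤ 2ε²`; then `2ε²‖u‖² = 2ε ·
  -- ε‖u‖²`.
  refine (re_inner_cfc_le_of_resolvent hH f.continuous (b := 2 * ε ^ 2) (fun x => ?_) hu).trans ?_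
  · by_cases hx : x ∈ Metric.ball E ε
    · rw [Metric.mem_ball, Real.dist_eq] at hx
      have : (x - E) ^ 2 ≤ ε ^ 2 := sq_le_sq.2 (by rw [abs_of_pos hε]; exact hx.le)
      calc ((x - E) ^ 2 + ε ^ 2) * f x ≤ ((x - E) ^ 2 + ε ^ 2) * 1 :=
            mul_le_mul_of_nonneg_left (h01 x).2 (by positivity)
        _ ≤ 2 * ε ^ 2 := by linarith
    · rw [show f.toContinuousMap x = 0 from h0 x hx, mul_zero]
      positivity
  · nlinarith

end Spectral

/-! ### Differentiation of measures -/

/-- A finite measure on `ℝ` with finite upper density at the points of `S` does not charge the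
Lebesgue null subsets of `S`. -/
theorem measure_eq_zero_of_upperDensity_lt_top (μ : Measure ℝ) [IsFiniteMeasure μ] {S : Set ℝ}
    (hS : ∀ E ∈ S, ∃ b : ℝ, ∀ δ : ℝ, 0 < δ → δ ≤ 1 / 2 →
      μ (Metric.closedBall E δ) ≤ ENNReal.ofReal (δ * b)) (hS0 : volume S = 0) : μ S = 0 := by
  let A : ℕ → Set ℝ := fun n => {E ∈ S | ∀ δ : ℝ, 0 < δ → δ ≤ 1 / 2 →
      μ (Metric.closedBall E δ) ≤ ENNReal.ofReal (δ * n)}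
  have hA : S ⊆ ⋃ n, A n := fun E hE => by
    obtain ⟨b, hb⟩ := hS E hE
    obtain ⟨n, hn⟩ := exists_nat_ge b
    exact mem_iUnion.2 ⟨n, hE, fun δ h0 h1 => (hb δ h0 h1).trans
      (ENNReal.ofReal_le_ofReal (mul_le_mul_of_nonneg_left hn h0.le))⟩
  refine measure_mono_null hA (measure_iUnion_null fun n => ?_)
  have : IsLocallyFiniteMeasure ((n : ℝ≥0∞) • (volume : Measure ℝ)) := by
    have : IsLocallyFiniteMeasure ((n : NNReal) • (volume : Measure ℝ)) := inferInstance
    exact this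
  -- The Besicovitch family is adapted to `μ` itself, so `μ ≪ μ` is all that is needed, and the
  -- comparison is valid for the possibly non-measurable `A n`.
  have hle := (Besicovitch.vitaliFamily μ).measure_le_of_frequently_le
    ((n : ℝ≥0∞) • (volume : Measure ℝ)) Measure.AbsolutelyContinuous.rfl (A n) (fun E hE => by
      refine (Besicovitch.tendsto_filterAt μ E).frequently (Eventually.frequently ?_)
      filter_upwards [Ioc_mem_nhdsGT (show (0 : ℝ) < 1 / 2 by norm_num)] with δ hδ
      refine (hE.2 δ hδ.1 hδ.2).trans ?_
      rw [Measure.smul_apply, Real.volume_closedBall, smul_eq_mul,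
        ENNReal.ofReal_mul hδ.1.le, ENNReal.ofReal_natCast, mul_comm]
      gcongr
      linarith [hδ.1])
  have h0 : volume (A n) = 0 := measure_mono_null (fun E hE => hE.1) hS0
  rw [Measure.smul_apply, h0, smul_zero] at hle
  exact nonpos_iff_eq_zero.1 hle

/-! ### The resolvent criterion for absolute continuity -/

section Criterion

variable {𝓗 : Type*} [NormedAddCommGroup 𝓗] [InnerProductSpace ℂ 𝓗] [CompleteSpace 𝓗]

/-- If the vectors of a set `D` with dense additive span have bounded `ε ‖(H - E - iε)⁻¹ ψ‖²` as
`ε → 0`, for each energy `E ∈ S`, then `H` is purely absolutely continuous on `S`. -/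
theorem isPurelyAbsolutelyContinuousOn_of_resolvent_bound {H : 𝓗 →L[ℂ] 𝓗} (hH : IsSelfAdjoint H)
    {S : Set ℝ} {D : Set 𝓗} (hD : Dense (AddSubmonoid.closure D : Set 𝓗))
    (hb : ∀ ψ ∈ D, ∀ E ∈ S, ∃ b : ℝ, ∀ (ε : ℝ) (u : 𝓗), 0 < ε → ε ≤ 1 →
      H u - ((E : ℂ) + ε * Complex.I) • u = ψ → ε * ‖u‖ ^ 2 ≤ b) :
    IsPurelyAbsolutelyContinuousOn H hH S := by
  intro ψ
  refine Measure.AbsolutelyContinuous.mk fun N hN hN0 => ?_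
  rw [Measure.restrict_apply hN]
  have hDz : ∀ χ ∈ D, spectralMeasure H hH χ (N ∩ S) = 0 := fun χ hχ => by
    refine measure_eq_zero_of_upperDensity_lt_top _ (fun E hE => ?_)
      (measure_mono_null inter_subset_left hN0)
    obtain ⟨b, hb⟩ := hb χ hχ E hE.2
    -- Take `ε = 2δ`: the ball of radius `ε / 2` has mass at most `2εb = 4δb`, and `δ ≤ 1/2` gives
    -- `ε ≤ 1`.
    refine ⟨4 * b, fun δ h0 h1 => ?_⟩
    obtain ⟨u, hu⟩ := exists_resolvent_eq hH E (show 0 < 2 * δ by linarith) χ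
    have h := spectralMeasure_closedBall_le hH (by linarith) hu
      (hb _ u (by linarith) (by linarith) hu)
    rw [show 2 * δ / 2 = δ by ring] at h
    exact h.trans_eq (by ring_nf)
  have h0 : ∀ χ ∈ AddSubmonoid.closure D, spectralMeasure H hH χ (N ∩ S) = 0 := fun χ hχ => by
    induction hχ using AddSubmonoid.closure_induction with
    | mem x hx => exact hDz x hx
    | zero =>
      refine measure_mono_null (subset_univ _) (nonpos_iff_eq_zero.1 ?_)
      simpa using spectralMeasure_univ_le hH (0 : 𝓗)
    | add x y _ _ hx hy =>
      have := spectralMeasure_add_le hH x y (N ∩ S)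
      rw [hx, hy] at this
      simpa using this
  exact (isClosed_spectralMeasure_eq_zero hH (N ∩ S)).closure_subset_iff.2 h0 (hD ψ)

end Criterion

/-! ### Averaging along a ray -/

/-- A sequence that is bounded by a square summable sequence `B y`, and whose increments are bounded
by `B ε y`, starts below a multiple of `√ε ‖y‖₂`. -/
theorem norm_sq_le_of_slowly_varying {W : ℕ → ℂ} {y : ℕ → ℝ} {B ε S : ℝ} (hB : 0 ≤ B)
    (hε : 0 < ε) (hε1 : ε ≤ 1) (hy : ∀ j, 0 ≤ y j)
    (hS : ∀ L, ∑ j ∈ Finset.range L, y j ^ 2 ≤ S)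
    (hW : ∀ j, ‖W j‖ ≤ B * y j) (hdW : ∀ j, ‖W (j + 1) - W j‖ ≤ B * (ε * y j)) :
    ‖W 0‖ ^ 2 ≤ 8 * B ^ 2 * (ε * S) := by
  -- The window `L ≈ 1/ε` balances two errors: the average of `y` is at most `εY`, of the same order
  -- as the accumulated drift.
  obtain ⟨L, hL1, hL2⟩ : ∃ L : ℕ, 1 ≤ L * ε ∧ L * ε ≤ 2 := by
    refine ⟨⌈1 / ε⌉₊, ?_, ?_⟩
    · have := Nat.le_ceil (1 / ε)
      rwa [div_le_iff₀ hε] at this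
    · have := (Nat.ceil_lt_add_one (by positivity : 0 ≤ 1 / ε)).le
      have h2 := mul_le_mul_of_nonneg_right this hε.le
      rw [add_mul, one_div, inv_mul_cancel₀ hε.ne'] at h2
      rw [one_div]; linarith
  set Y := ∑ j ∈ Finset.range L, y j with hY
  have hY0 : 0 ≤ Y := Finset.sum_nonneg fun j _ => hy j
  have htel : ∀ N ∈ Finset.range L, ‖W 0‖ ≤ B * y N + B * (ε * Y) := fun N hN => by
    have h1 : ‖W N - W 0‖ ≤ B * (ε * Y) := by
      rw [← Finset.sum_range_sub]
      refine (norm_sum_le _ _).trans ((Finset.sum_le_sum fun j _ => hdW j).trans ?_)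
      rw [← Finset.mul_sum, ← Finset.mul_sum]
      have : ∑ j ∈ Finset.range N, y j ≤ Y :=
        Finset.sum_le_sum_of_subset_of_nonneg
          (Finset.range_subset_range.2 (Finset.mem_range.1 hN).le) fun j _ _ => hy j
      gcongr
    have h2 := norm_sub_le (W N) (W N - W 0)
    rw [sub_sub_cancel] at h2
    linarith [hW N]
  have hsum : L * ‖W 0‖ ≤ B * Y + L * (B * (ε * Y)) := by
    have := Finset.sum_le_sum htel
    rwa [Finset.sum_add_distrib, ← Finset.mul_sum, Finset.sum_const, Finset.sum_const,
      Finset.card_range, nsmul_eq_mul, nsmul_eq_mul] at this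
  have hcs : Y ^ 2 ≤ L * S := by
    have := sq_sum_le_card_mul_sum_sq (s := Finset.range L) (f := y)
    rw [Finset.card_range] at this
    exact this.trans (mul_le_mul_of_nonneg_left (hS L) (Nat.cast_nonneg _))
  have hS0 : 0 ≤ S := by simpa using hS 0
  have h3 : ‖W 0‖ ≤ 2 * B * (ε * Y) := by
    -- Multiply the summed bound by `ε`; since `Lε ≥ 1`, the averaged term is absorbed into the
    -- drift term.
    have h4 : (L * ε) * ‖W 0‖ ≤ (L * ε) * (2 * B * (ε * Y)) := by
      have h5 := mul_le_mul_of_nonneg_left hsum hε.le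
      have h6 : B * (ε * Y) ≤ (L * ε) * (B * (ε * Y)) :=
        le_mul_of_one_le_left (by positivity) hL1
      nlinarith
    exact le_of_mul_le_mul_left h4 (by linarith)
  calc ‖W 0‖ ^ 2 ≤ (2 * B * (ε * Y)) ^ 2 := by gcongr
    _ = 4 * B ^ 2 * ε ^ 2 * Y ^ 2 := by ring
    _ ≤ 4 * B ^ 2 * ε ^ 2 * (L * S) := by gcongr
    _ = 4 * B ^ 2 * (ε * S) * (L * ε) := by ring
    _ ≤ 4 * B ^ 2 * (ε * S) * 2 := by gcongr
    _ = 8 * B ^ 2 * (ε * S) := by ring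

theorem sum_norm_sq_le {𝕍 : Type*} [NormedAddCommGroup 𝕍]
    (u : lp (fun _ : ℤ => 𝕍) 2) {g : ℕ → ℤ} (hg : Function.Injective g) (L : ℕ) :
    ∑ j ∈ Finset.range L, ‖u (g j)‖ ^ 2 ≤ ‖u‖ ^ 2 := by
  have h := lp.sum_rpow_le_norm_rpow two_toReal_pos u ((Finset.range L).map ⟨g, hg⟩)
  simpa using h

theorem norm_apply_le {𝕍 : Type*} [NormedAddCommGroup 𝕍]
    (u : lp (fun _ : ℤ => 𝕍) 2) (n : ℤ) : ‖u n‖ ≤ ‖u‖ :=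
  lp.norm_apply_le_norm (by norm_num) u n

theorem sum_sq_add_le {𝕍 : Type*} [NormedAddCommGroup 𝕍]
    (u : lp (fun _ : ℤ => 𝕍) 2) {g h : ℕ → ℤ} (hg : Function.Injective g)
    (hh : Function.Injective h) (L : ℕ) :
    ∑ j ∈ Finset.range L, (‖u (g j)‖ + ‖u (h j)‖) ^ 2 ≤ 4 * ‖u‖ ^ 2 := by
  calc ∑ j ∈ Finset.range L, (‖u (g j)‖ + ‖u (h j)‖) ^ 2
      ≤ ∑ j ∈ Finset.range L, 2 * (‖u (g j)‖ ^ 2 + ‖u (h j)‖ ^ 2) :=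
        Finset.sum_le_sum fun j _ => add_sq_le
    _ ≤ 4 * ‖u‖ ^ 2 := by
        rw [← Finset.mul_sum, Finset.sum_add_distrib]
        linarith [sum_norm_sq_le u hg L, sum_norm_sq_le u hh L]

/-! ### The Wronskian -/

section Wronskian

variable {𝕍 : Type*} [NormedAddCommGroup 𝕍] [InnerProductSpace ℂ 𝕍]

/-- The Wronskian of two `ℂᵐ`-valued sequences for the hopping terms `c` and `d = c*`. -/
def wronskian (c d : 𝕍 →L[ℂ] 𝕍) (φ u : ℤ → 𝕍) (n : ℤ) : ℂ :=
  inner ℂ (φ (n - 1)) (c (u n)) - inner ℂ (φ n) (d (u (n - 1)))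

theorem wronskian_add (c d : 𝕍 →L[ℂ] 𝕍) (φ φ' u : ℤ → 𝕍) (n : ℤ) :
    wronskian c d (φ + φ') u n = wronskian c d φ u n + wronskian c d φ' u n := by
  simp only [wronskian, Pi.add_apply, inner_add_left]
  ring

/-- `φ` is a generalized eigenfunction, at energy `E`, of the operator with hopping terms `c`, `d`
and potential `q`. -/
def IsGeneralizedEigenfunction (c d : 𝕍 →L[ℂ] 𝕍) (q : ℤ → 𝕍 →L[ℂ] 𝕍) (E : ℝ) (φ : ℤ → 𝕍) :
    Prop :=
  ∀ n, c (φ (n + 1)) + q n (φ n) + d (φ (n - 1)) = (E : ℂ) • φ n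

variable {c d : 𝕍 →L[ℂ] 𝕍} {q : ℤ → 𝕍 →L[ℂ] 𝕍} {E : ℝ} {φ u : ℤ → 𝕍}

/-- Discrete Green identity: pair the equation of `u` with `φ n`, pair that of `φ` with `u n`, and
subtract. The potential cancels by symmetry, the energy because it is real. -/
theorem wronskian_succ_sub (hcd : ∀ x y, inner ℂ (c x) y = inner ℂ x (d y))
    (hq : ∀ n x y, inner ℂ (q n x) y = inner ℂ x (q n y))
    (hφ : IsGeneralizedEigenfunction c d q E φ) {f : ℤ → 𝕍} {n : ℤ}
    (hu : c (u (n + 1)) + q n (u n) + d (u (n - 1)) = (E : ℂ) • u n + f n) :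
    wronskian c d φ u (n + 1) - wronskian c d φ u n = inner ℂ (φ n) (f n) := by
  have hdc : ∀ x y, inner ℂ (d x) y = inner ℂ x (c y) := fun x y => by
    rw [← inner_conj_symm, ← hcd, inner_conj_symm]
  have h1 := congrArg (fun x => inner ℂ (φ n) x) hu
  have h2 := congrArg (fun x => inner ℂ x (u n)) (hφ n)
  simp only [inner_add_left, inner_add_right, inner_smul_left, inner_smul_right, hcd, hdc, hq,
    Complex.conj_ofReal] at h1 h2
  simp only [wronskian, add_sub_cancel_right]
  linear_combination h1 - h2

theorem norm_wronskian_le {M Γ : ℝ} (hc : ‖c‖ ≤ Γ) (hd : ‖d‖ ≤ Γ) {n : ℤ} (h1 : ‖φ n‖ ≤ M)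
    (h2 : ‖φ (n - 1)‖ ≤ M) : ‖wronskian c d φ u n‖ ≤ M * Γ * (‖u n‖ + ‖u (n - 1)‖) := by
  have hM : 0 ≤ M := (norm_nonneg _).trans h1
  have hΓ : 0 ≤ Γ := (norm_nonneg _).trans hc
  have e1 : ‖inner ℂ (φ (n - 1)) (c (u n))‖ ≤ M * (Γ * ‖u n‖) :=
    (norm_inner_le_norm _ _).trans
      (mul_le_mul h2 (c.le_of_opNorm_le hc _) (norm_nonneg _) hM)
  have e2 : ‖inner ℂ (φ n) (d (u (n - 1)))‖ ≤ M * (Γ * ‖u (n - 1)‖) :=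
    (norm_inner_le_norm _ _).trans
      (mul_le_mul h1 (d.le_of_opNorm_le hd _) (norm_nonneg _) hM)
  refine (norm_sub_le _ _).trans ?_
  linarith

/-- `u` solves `(H - E - iε) u = δ_k ⊗ w` for the operator `H` with hopping terms `c`, `d` and
potential `q`. -/
def IsGreenFunction (c d : 𝕍 →L[ℂ] 𝕍) (q : ℤ → 𝕍 →L[ℂ] 𝕍) (E ε : ℝ) (k : ℤ) (w : 𝕍)
    (u : ℤ → 𝕍) : Prop :=
  ∀ n, c (u (n + 1)) + q n (u n) + d (u (n - 1)) =
    (E : ℂ) • u n + (((ε : ℂ) * Complex.I) • u n + Pi.single (M := fun _ => 𝕍) k w n)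

theorem IsGreenFunction.wronskian_succ_sub (hcd : ∀ x y, inner ℂ (c x) y = inner ℂ x (d y))
    (hq : ∀ n x y, inner ℂ (q n x) y = inner ℂ x (q n y))
    (hφ : IsGeneralizedEigenfunction c d q E φ) {ε : ℝ} {k : ℤ} {w : 𝕍}
    (hu : IsGreenFunction c d q E ε k w u) (n : ℤ) :
    wronskian c d φ u (n + 1) - wronskian c d φ u n =
      inner ℂ (φ n) (((ε : ℂ) * Complex.I) • u n + Pi.single (M := fun _ => 𝕍) k w n) :=
  StripSchrodinger.wronskian_succ_sub hcd hq hφ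
    (f := fun n => ((ε : ℂ) * Complex.I) • u n + Pi.single (M := fun _ => 𝕍) k w n) (hu n)

/-- Off the source site only the `iε` term feeds the Wronskian increment, which is why the Wronskian
varies slowly. -/
theorem norm_inner_le_of_ne {ε M : ℝ} (hε : 0 < ε) {k n : ℤ} {w : 𝕍} (hn : n ≠ k)
    (hM : ‖φ n‖ ≤ M) :
    ‖inner ℂ (φ n) (((ε : ℂ) * Complex.I) • u n + Pi.single (M := fun _ => 𝕍) k w n)‖ ≤
      M * (ε * ‖u n‖) := by
  rw [Pi.single_eq_of_ne hn, add_zero]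
  refine (norm_inner_le_norm _ _).trans ?_
  rw [norm_smul]
  simp only [Complex.norm_mul, Complex.norm_I, mul_one, Complex.norm_real, Real.norm_eq_abs,
    abs_of_pos hε]
  gcongr

/-- The Wronskian at `k` of a Green function at `k` and a generalized eigenfunction that is
bounded on the left half-line. -/
theorem wronskian_sq_le_of_bounded_left (hcd : ∀ x y, inner ℂ (c x) y = inner ℂ x (d y))
    (hq : ∀ n x y, inner ℂ (q n x) y = inner ℂ x (q n y))
    (hφ : IsGeneralizedEigenfunction c d q E φ) (k : ℤ) (w : 𝕍)
    (hb : BddAbove ((fun n => ‖φ n‖) '' Iic k)) :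
    ∃ K : ℝ, 0 ≤ K ∧ ∀ (ε : ℝ) (u : lp (fun _ : ℤ => 𝕍) 2), 0 < ε → ε ≤ 1 →
      IsGreenFunction c d q E ε k w u → ‖wronskian c d φ u k‖ ^ 2 ≤ K * (1 + ε * ‖u‖ ^ 2) := by
  obtain ⟨M, hM⟩ := hb
  replace hM : ∀ n ≤ k, ‖φ n‖ ≤ M := fun n hn => hM ⟨n, hn, rfl⟩
  have hM0 : 0 ≤ M := (norm_nonneg _).trans (hM k le_rfl)
  set Γ := ‖c‖ + ‖d‖ with hΓ
  have hc : ‖c‖ ≤ Γ := le_add_of_nonneg_right (norm_nonneg _)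
  have hd : ‖d‖ ≤ Γ := le_add_of_nonneg_left (norm_nonneg _)
  have hΓ0 : 0 ≤ Γ := (norm_nonneg _).trans hc
  refine ⟨8 * (M * (1 + Γ)) ^ 2 * 4, by positivity, fun ε u hε hε1 hu => ?_⟩
  -- Walking left from `k`, the increments sit at sites `k - j - 1`, so the source at `k` is never
  -- met. The constant `M(1 + Γ)` serves both for the size (`MΓ`) and for the drift (`M`).
  have h := norm_sq_le_of_slowly_varying (W := fun j : ℕ => wronskian c d φ u (k - j))
    (y := fun j : ℕ => ‖u (k - j)‖ + ‖u (k - j - 1)‖) (B := M * (1 + Γ)) (ε := ε)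
    (S := 4 * ‖u‖ ^ 2) (by positivity) hε hε1 (fun j => by positivity)
    (sum_sq_add_le u (fun i j hij => by simpa using hij) (fun i j hij => by simpa using hij))
    (fun j => (norm_wronskian_le hc hd (hM _ (by omega)) (hM _ (by omega))).trans
      (mul_le_mul_of_nonneg_right (mul_le_mul_of_nonneg_left (by linarith) hM0) (by positivity)))
    (fun j => by
      have e := hu.wronskian_succ_sub hcd hq hφ (k - j - 1)
      rw [sub_add_cancel] at e
      rw [show k - ((j + 1 : ℕ) : ℤ) = k - j - 1 by push_cast; ring, norm_sub_rev, e]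
      refine (norm_inner_le_of_ne hε (by omega) (hM _ (by omega))).trans ?_
      refine mul_le_mul (le_mul_of_one_le_right hM0 (by linarith)) ?_ (by positivity)
        (by positivity)
      gcongr
      exact le_add_of_nonneg_left (norm_nonneg _))
  simp only [Nat.cast_zero, sub_zero] at h
  refine h.trans ?_
  have : 0 ≤ (M * (1 + Γ)) ^ 2 := sq_nonneg _
  nlinarith

/-- The Wronskian at `k` of a Green function at `k` and a generalized eigenfunction that is
bounded on the right half-line. -/
theorem wronskian_sq_le_of_bounded_right (hcd : ∀ x y, inner ℂ (c x) y = inner ℂ x (d y))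
    (hq : ∀ n x y, inner ℂ (q n x) y = inner ℂ x (q n y))
    (hφ : IsGeneralizedEigenfunction c d q E φ) (k : ℤ) (w : 𝕍)
    (hb : BddAbove ((fun n => ‖φ n‖) '' Ici k)) :
    ∃ K : ℝ, 0 ≤ K ∧ ∀ (ε : ℝ) (u : lp (fun _ : ℤ => 𝕍) 2), 0 < ε → ε ≤ 1 →
      IsGreenFunction c d q E ε k w u → ‖wronskian c d φ u k‖ ^ 2 ≤ K * (1 + ε * ‖u‖ ^ 2) := by
  obtain ⟨M, hM⟩ := hb
  replace hM : ∀ n, k ≤ n → ‖φ n‖ ≤ M := fun n hn => hM ⟨n, hn, rfl⟩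
  have hM0 : 0 ≤ M := (norm_nonneg _).trans (hM k le_rfl)
  set Γ := ‖c‖ + ‖d‖ with hΓ
  have hc : ‖c‖ ≤ Γ := le_add_of_nonneg_right (norm_nonneg _)
  have hd : ‖d‖ ≤ Γ := le_add_of_nonneg_left (norm_nonneg _)
  have hΓ0 : 0 ≤ Γ := (norm_nonneg _).trans hc
  refine ⟨3 * (8 * (M * (1 + Γ)) ^ 2 * 4 + M ^ 2 + (M * ‖w‖) ^ 2), by positivity,
    fun ε u hε hε1 hu => ?_⟩
  -- The walk to the right starts at `k + 1`, because the increment from `k` to `k + 1` contains the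
  -- source; that one step is paid for separately in `h0`.
  have h := norm_sq_le_of_slowly_varying (W := fun j : ℕ => wronskian c d φ u (k + 1 + j))
    (y := fun j : ℕ => ‖u (k + 1 + j)‖ + ‖u (k + 1 + j - 1)‖) (B := M * (1 + Γ)) (ε := ε)
    (S := 4 * ‖u‖ ^ 2) (by positivity) hε hε1 (fun j => by positivity)
    (sum_sq_add_le u (fun i j hij => by simpa using hij) (fun i j hij => by simpa using hij))
    (fun j => (norm_wronskian_le hc hd (hM _ (by omega)) (hM _ (by omega))).trans
      (mul_le_mul_of_nonneg_right (mul_le_mul_of_nonneg_left (by linarith) hM0) (by positivity)))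
    (fun j => by
      have e := hu.wronskian_succ_sub hcd hq hφ (k + 1 + j)
      rw [show k + 1 + ((j + 1 : ℕ) : ℤ) = k + 1 + j + 1 by push_cast; ring, e]
      refine (norm_inner_le_of_ne hε (by omega) (hM _ (by omega))).trans ?_
      refine mul_le_mul (le_mul_of_one_le_right hM0 (by linarith)) ?_ (by positivity)
        (by positivity)
      gcongr
      exact le_add_of_nonneg_right (norm_nonneg _))
  simp only [Nat.cast_zero, add_zero] at h
  have h0 : ‖wronskian c d φ u k‖ ≤
      ‖wronskian c d φ u (k + 1)‖ + M * (ε * ‖u‖) + M * ‖w‖ := by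
    have e := hu.wronskian_succ_sub hcd hq hφ k
    rw [inner_add_right, Pi.single_eq_same, inner_smul_right] at e
    have e' : wronskian c d φ u k = wronskian c d φ u (k + 1) -
        (ε * Complex.I * inner ℂ (φ k) (u k) + inner ℂ (φ k) w) := by rw [← e]; ring
    rw [e']
    refine (norm_sub_le _ _).trans ?_
    rw [add_assoc]
    refine add_le_add le_rfl ((norm_add_le _ _).trans (add_le_add ?_ ?_))
    · rw [norm_mul, norm_mul, Complex.norm_I, Complex.norm_real, Real.norm_eq_abs,
        abs_of_pos hε, mul_one]
      calc ε * ‖inner ℂ (φ k) (u k)‖ ≤ ε * (M * ‖u‖) := by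
            gcongr
            exact (norm_inner_le_norm _ _).trans
              (mul_le_mul (hM k le_rfl) (norm_apply_le u k) (norm_nonneg _) hM0)
        _ = M * (ε * ‖u‖) := by ring
    · exact (norm_inner_le_norm _ _).trans
        (mul_le_mul_of_nonneg_right (hM k le_rfl) (norm_nonneg _))
  have hsq : ‖wronskian c d φ u k‖ ^ 2 ≤
      3 * (‖wronskian c d φ u (k + 1)‖ ^ 2 + (M * (ε * ‖u‖)) ^ 2 + (M * ‖w‖) ^ 2) := by
    refine (pow_le_pow_left₀ (norm_nonneg _) h0 2).trans ?_
    nlinarith [sq_nonneg (‖wronskian c d φ u (k + 1)‖ - M * (ε * ‖u‖)),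
      sq_nonneg (‖wronskian c d φ u (k + 1)‖ - M * ‖w‖), sq_nonneg (M * (ε * ‖u‖) - M * ‖w‖)]
  refine hsq.trans ?_
  have hε2 : (M * (ε * ‖u‖)) ^ 2 ≤ M ^ 2 * (ε * ‖u‖ ^ 2) := by
    have : ε * ε ≤ ε * 1 := mul_le_mul_of_nonneg_left hε1 hε.le
    calc (M * (ε * ‖u‖)) ^ 2 = M ^ 2 * ‖u‖ ^ 2 * (ε * ε) := by ring
      _ ≤ M ^ 2 * ‖u‖ ^ 2 * (ε * 1) := by gcongr
      _ = _ := by ring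
  have p1 : 0 ≤ (M * (1 + Γ)) ^ 2 := sq_nonneg _
  have p2 : 0 ≤ (M * ‖w‖) ^ 2 * (ε * ‖u‖ ^ 2) := by positivity
  have p3 : 0 ≤ M ^ 2 := sq_nonneg _
  nlinarith

end Wronskian

/-! ### Iterates of an invertible cocycle -/

section Iterates

variable {Ω : Type*} [TopologicalSpace Ω] {ι : Type*} [Fintype ι] [DecidableEq ι]
  {T : Ω ≃ₜ Ω} {A : Ω → Matrix ι ι ℂ}

theorem isUnit_cocycleIterNat (hA : ∀ x, IsUnit (A x)) (n : ℕ) (x : Ω) :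
    IsUnit (cocycleIterNat T A n x) := by
  induction n with
  | zero => exact isUnit_one
  | succ n ih => exact (hA _).mul ih

theorem isUnit_cocycleIter (hA : ∀ x, IsUnit (A x)) (n : ℤ) (x : Ω) :
    IsUnit (cocycleIter T A n x) := by
  cases n with
  | ofNat n => exact isUnit_cocycleIterNat hA n x
  | negSucc n => exact (Matrix.isUnit_nonsing_inv_iff).2 (isUnit_cocycleIterNat hA _ _)

theorem cocycleIterNat_succ' (n : ℕ) (x : Ω) :
    cocycleIterNat T A (n + 1) x = cocycleIterNat T A n (T x) * A x := by
  induction n with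
  | zero => simp [cocycleIterNat]
  | succ n ih =>
    rw [cocycleIterNat, ih, ← mul_assoc]
    congr 1

theorem cocycleIter_neg (n : ℕ) (x : Ω) :
    cocycleIter T A (-n) x = (cocycleIterNat T A n ((T ^ (-n : ℤ)) x))⁻¹ := by
  cases n with
  | zero => exact inv_one.symm
  | succ n => rfl

/-- For negative times the inverted product is based at `T^n ω`; peeling off its initial factor, as
in `cocycleIterNat_succ'`, exposes the matrix that cancels. -/
theorem cocycleIter_add_one (hA : ∀ x, IsUnit (A x)) (n : ℤ) (x : Ω) :
    cocycleIter T A (n + 1) x = A ((T ^ n) x) * cocycleIter T A n x := by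
  cases n with
  | ofNat n => rfl
  | negSucc n =>
    have h : T ((T ^ (Int.negSucc n)) x) = (T ^ (-n : ℤ)) x := by
      rw [show (-n : ℤ) = 1 + Int.negSucc n by rw [Int.negSucc_eq]; ring, zpow_add, zpow_one]
      rfl
    rw [show Int.negSucc n + 1 = (-n : ℤ) by rw [Int.negSucc_eq]; ring, cocycleIter_neg,
      cocycleIter, cocycleIterNat_succ', Matrix.mul_inv_rev, h, ← mul_assoc,
      Matrix.mul_nonsing_inv _ ((Matrix.isUnit_iff_isUnit_det _).1 (hA _)), one_mul]

/-- The vectors of the stable bundle have bounded forward orbits. -/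
theorem IsPartiallyHyperbolicSplitting.bounded_stable
    {Eu Ec Es : Ω → Submodule ℂ (EuclideanSpace ℂ ι)}
    (h : IsPartiallyHyperbolicSplitting T A Eu Ec Es) {ω : Ω} {v : EuclideanSpace ℂ ι}
    (hv : v ∈ Es ω) : ∃ M : ℝ, ∀ n : ℤ, 0 ≤ n → ‖act (cocycleIter T A n ω) v‖ ≤ M := by
  obtain ⟨K, hK, c, hc, hKc⟩ := h.uniform
  refine ⟨K * 1 * ‖v‖, fun n hn => ?_⟩
  lift n to ℕ using hn
  refine ((hKc n ω).1 v hv).trans ?_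
  gcongr
  exact Real.exp_le_one_iff.2 (by nlinarith [(Nat.cast_nonneg n : (0 : ℝ) ≤ n)])

/-- The vectors of the unstable bundle have bounded backward orbits. -/
theorem IsPartiallyHyperbolicSplitting.bounded_unstable
    {Eu Ec Es : Ω → Submodule ℂ (EuclideanSpace ℂ ι)}
    (h : IsPartiallyHyperbolicSplitting T A Eu Ec Es) {ω : Ω} {v : EuclideanSpace ℂ ι}
    (hv : v ∈ Eu ω) : ∃ M : ℝ, ∀ n : ℤ, n ≤ 0 → ‖act (cocycleIter T A n ω) v‖ ≤ M := by
  obtain ⟨K, hK, c, hc, hKc⟩ := h.uniform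
  refine ⟨K * 1 * ‖v‖, fun n hn => ?_⟩
  obtain ⟨k, rfl⟩ := Int.exists_eq_neg_ofNat hn
  rw [cocycleIter_neg]
  have hT : (T ^ k) ((T ^ (-k : ℤ)) ω) = ω := by
    have : T ^ k * T ^ (-k : ℤ) = 1 := by rw [zpow_neg, zpow_natCast, mul_inv_cancel]
    exact congrArg (fun S : Ω ≃ₜ Ω => S ω) this
  refine ((hKc k ((T ^ (-k : ℤ)) ω)).2 v (by rwa [hT])).trans ?_
  gcongr
  exact Real.exp_le_one_iff.2 (by nlinarith [(Nat.cast_nonneg k : (0 : ℝ) ≤ k)])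

end Iterates

/-! ### Orbits of the Schrödinger cocycle are generalized eigenfunctions -/

section Orbits

variable {Ω : Type*} [MetricSpace Ω] {m : ℕ}

theorem isUnit_schrodingerCocycle (C : GL (Fin m) ℂ) (V : C(Ω, Her m)) (E : ℝ) (x : Ω) :
    IsUnit (schrodingerCocycle C V E x) := by
  set M := (C : Matrix (Fin m) (Fin m) ℂ) with hM
  have hC : IsUnit M.det := (Matrix.isUnit_iff_isUnit_det _).1 C.isUnit
  have hC' : IsUnit Mᴴ.det := by rw [Matrix.det_conjTranspose]; exact hC.star
  set a := M⁻¹ * ((E : ℂ) • (1 : Matrix (Fin m) (Fin m) ℂ) - (V x : Matrix (Fin m) (Fin m) ℂ))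
  -- Solving `A(p, q) = (x, y)` gives `p = y` and `q = (Mᴴ)⁻¹M(ay - x)`; a one-sided inverse
  -- suffices for square matrices.
  refine IsUnit.of_mul_eq_one (Matrix.fromBlocks 0 1 (-(Mᴴ⁻¹ * M)) (Mᴴ⁻¹ * (M * a))) ?_
  rw [schrodingerCocycle, Matrix.fromBlocks_multiply, ← Matrix.fromBlocks_one]
  have h1 : M⁻¹ * Mᴴ * (Mᴴ⁻¹ * M) = 1 := by
    rw [mul_assoc, Matrix.mul_nonsing_inv_cancel_left _ _ hC', Matrix.nonsing_inv_mul _ hC]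
  have h2 : M⁻¹ * Mᴴ * (Mᴴ⁻¹ * (M * a)) = a := by
    rw [mul_assoc, Matrix.mul_nonsing_inv_cancel_left _ _ hC',
      Matrix.nonsing_inv_mul_cancel_left _ _ hC]
  congr 1
  · simpa using h1
  · rw [mul_one, neg_mul, h2]; exact add_neg_cancel a
  · simp
  · simp

/-- The upper half of a vector of `ℂ²ᵐ`. -/
def upper (x : EuclideanSpace ℂ (Fin m ⊕ Fin m)) : EuclideanSpace ℂ (Fin m) :=
  WithLp.toLp 2 fun i => x (Sum.inl i)

/-- The lower half of a vector of `ℂ²ᵐ`. -/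
def lower (x : EuclideanSpace ℂ (Fin m ⊕ Fin m)) : EuclideanSpace ℂ (Fin m) :=
  WithLp.toLp 2 fun i => x (Sum.inr i)

theorem norm_upper_le (x : EuclideanSpace ℂ (Fin m ⊕ Fin m)) : ‖upper x‖ ≤ ‖x‖ := by
  rw [EuclideanSpace.norm_eq, EuclideanSpace.norm_eq]
  refine Real.sqrt_le_sqrt ?_
  rw [Fintype.sum_sum_type]
  exact le_add_of_nonneg_right (Finset.sum_nonneg fun i _ => sq_nonneg _)

theorem lower_act (C : GL (Fin m) ℂ) (V : C(Ω, Her m)) (E : ℝ) (x : Ω)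
    (v : EuclideanSpace ℂ (Fin m ⊕ Fin m)) :
    lower (act (schrodingerCocycle C V E x) v) = upper v := by
  ext i
  simp [lower, upper, act, schrodingerCocycle, Matrix.ofLp_toEuclideanCLM, Matrix.mulVec,
    dotProduct, Fintype.sum_sum_type, Matrix.one_apply]

theorem upper_act (C : GL (Fin m) ℂ) (V : C(Ω, Her m)) (E : ℝ) (x : Ω)
    (v : EuclideanSpace ℂ (Fin m ⊕ Fin m)) :
    act (C : Matrix (Fin m) (Fin m) ℂ) (upper (act (schrodingerCocycle C V E x) v)) =
      (E : ℂ) • upper v - act (V x : Matrix (Fin m) (Fin m) ℂ) (upper v)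
        - act (C : Matrix (Fin m) (Fin m) ℂ)ᴴ (lower v) := by
  set M := (C : Matrix (Fin m) (Fin m) ℂ) with hM
  have hC : IsUnit M.det := (Matrix.isUnit_iff_isUnit_det _).1 C.isUnit
  have h : upper (act (schrodingerCocycle C V E x) v) =
      act (M⁻¹ * ((E : ℂ) • (1 : Matrix (Fin m) (Fin m) ℂ) -
        (V x : Matrix (Fin m) (Fin m) ℂ))) (upper v)
        - act (M⁻¹ * Mᴴ) (lower v) := by
    rw [schrodingerCocycle, ← hM]
    generalize (E : ℂ) • (1 : Matrix (Fin m) (Fin m) ℂ) - (V x : Matrix (Fin m) (Fin m) ℂ) = N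
    ext i
    simp [lower, upper, act, Matrix.ofLp_toEuclideanCLM, Matrix.mulVec,
      dotProduct, Fintype.sum_sum_type, sub_eq_add_neg]
  have hmul : ∀ (N : Matrix (Fin m) (Fin m) ℂ) (y : EuclideanSpace ℂ (Fin m)),
      act M (act (M⁻¹ * N) y) = act N y := fun N y => by
    rw [act, act, ← mul_apply_eq_comp, ← map_mul, Matrix.mul_nonsing_inv_cancel_left _ _ hC]
  rw [h, map_sub, hmul, hmul, act, map_sub, map_smul, map_one]
  rfl

/-- The first component of the orbit of `v` under the Schrödinger cocycle. -/
def orbitSeq (T : Ω ≃ₜ Ω) (C : GL (Fin m) ℂ) (V : C(Ω, Her m)) (E : ℝ) (ω : Ω)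
    (v : EuclideanSpace ℂ (Fin m ⊕ Fin m)) (n : ℤ) : EuclideanSpace ℂ (Fin m) :=
  upper (act (cocycleIter T (schrodingerCocycle C V E) n ω) v)

variable (T : Ω ≃ₜ Ω) (C : GL (Fin m) ℂ) (V : C(Ω, Her m)) (E : ℝ) (ω : Ω)

theorem orbitSeq_add (v w : EuclideanSpace ℂ (Fin m ⊕ Fin m)) :
    orbitSeq T C V E ω (v + w) = orbitSeq T C V E ω v + orbitSeq T C V E ω w := by
  funext n
  simp only [orbitSeq, map_add, Pi.add_apply]
  rfl

theorem act_cocycleIter_add_one (v : EuclideanSpace ℂ (Fin m ⊕ Fin m)) (n : ℤ) :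
    act (cocycleIter T (schrodingerCocycle C V E) (n + 1) ω) v =
      act (schrodingerCocycle C V E ((T ^ n) ω))
        (act (cocycleIter T (schrodingerCocycle C V E) n ω) v) := by
  rw [cocycleIter_add_one (isUnit_schrodingerCocycle C V E), act, act, act, map_mul]
  rfl

theorem orbitSeq_sub_one (v : EuclideanSpace ℂ (Fin m ⊕ Fin m)) (n : ℤ) :
    orbitSeq T C V E ω v (n - 1) =
      lower (act (cocycleIter T (schrodingerCocycle C V E) n ω) v) := by
  have h := act_cocycleIter_add_one T C V E ω v (n - 1)
  rw [sub_add_cancel] at h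
  rw [h, lower_act, orbitSeq]

/-- The orbit vector at time `n` is `(φ_n, φ_{n-1})`, and the first row of the cocycle is the
eigenvalue equation solved for `φ_{n+1}`. -/
theorem isGeneralizedEigenfunction_orbitSeq (v : EuclideanSpace ℂ (Fin m ⊕ Fin m)) :
    IsGeneralizedEigenfunction (act (C : Matrix (Fin m) (Fin m) ℂ))
      (act (C : Matrix (Fin m) (Fin m) ℂ)ᴴ)
      (fun n => act (V ((T ^ n) ω) : Matrix (Fin m) (Fin m) ℂ)) E (orbitSeq T C V E ω v) := by
  intro n
  rw [orbitSeq_sub_one, orbitSeq, act_cocycleIter_add_one, upper_act, orbitSeq]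
  abel

/-- Orbit bounds are available on half-lines ending at `0`, the Wronskian estimates need half-lines
ending at `k`; only finitely many sites separate them. -/
theorem bddAbove_orbitSeq_image {v : EuclideanSpace ℂ (Fin m ⊕ Fin m)} {s t : Set ℤ}
    (hb : ∃ M : ℝ, ∀ n ∈ s, ‖act (cocycleIter T (schrodingerCocycle C V E) n ω) v‖ ≤ M)
    (ht : (t \ s).Finite) : BddAbove ((fun n => ‖orbitSeq T C V E ω v n‖) '' t) := by
  obtain ⟨M, hM⟩ := hb
  have h2 := (ht.image fun n => ‖orbitSeq T C V E ω v n‖).bddAbove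
  have h1 : BddAbove ((fun n => ‖orbitSeq T C V E ω v n‖) '' s) :=
    ⟨M, by rintro _ ⟨n, hn, rfl⟩; exact (norm_upper_le _).trans (hM n hn)⟩
  refine (h1.union h2).mono ?_
  rw [← image_union, union_sdiff_self]
  exact image_mono subset_union_right

/-- At an energy with bounded center, the Wronskian at `k` of a Green function at `k` with any
generalized eigenfunction is controlled. -/
theorem wronskian_sq_le_of_mem_centerBoundedEnergies (hE : E ∈ centerBoundedEnergies T C V ω)
    (k : ℤ) (w : EuclideanSpace ℂ (Fin m)) (v : EuclideanSpace ℂ (Fin m ⊕ Fin m)) :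
    ∃ K : ℝ, 0 ≤ K ∧ ∀ (ε : ℝ) (u : StripSpace m), 0 < ε → ε ≤ 1 →
      IsGreenFunction (act (C : Matrix (Fin m) (Fin m) ℂ)) (act (C : Matrix (Fin m) (Fin m) ℂ)ᴴ)
        (fun n => act (V ((T ^ n) ω) : Matrix (Fin m) (Fin m) ℂ)) E ε k w u →
      ‖wronskian (act (C : Matrix (Fin m) (Fin m) ℂ)) (act (C : Matrix (Fin m) (Fin m) ℂ)ᴴ)
        (orbitSeq T C V E ω v) u k‖ ^ 2 ≤ K * (1 + ε * ‖u‖ ^ 2) := by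
  obtain ⟨Eu, Ec, Es, hph, Mc, hMc⟩ := hE
  have hcd := inner_toEuclideanCLM_conjTranspose (C : Matrix (Fin m) (Fin m) ℂ)
  have hq : ∀ (n : ℤ) (x y : EuclideanSpace ℂ (Fin m)),
      inner ℂ (act (V ((T ^ n) ω) : Matrix (Fin m) (Fin m) ℂ) x) y =
        inner ℂ x (act (V ((T ^ n) ω) : Matrix (Fin m) (Fin m) ℂ) y) := fun n x y => by
    have h : (V ((T ^ n) ω) : Matrix (Fin m) (Fin m) ℂ)ᴴ = V ((T ^ n) ω) := (V ((T ^ n) ω)).2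
    rw [inner_toEuclideanCLM_conjTranspose, h]
  have hright : (Ici k \ Ici (0 : ℤ)).Finite := (Set.finite_Icc k 0).subset fun n hn => by
    simp only [Set.mem_sdiff, mem_Ici, not_le] at hn
    exact ⟨hn.1, hn.2.le⟩
  have hleft : (Iic k \ Iic (0 : ℤ)).Finite := (Set.finite_Icc 0 k).subset fun n hn => by
    simp only [Set.mem_sdiff, mem_Iic, not_le] at hn
    exact ⟨hn.2.le, hn.1⟩
  have htop := (hph.isInternal ω).submodule_iSup_eq_top
  rw [iSup_fin_three] at htop
  obtain ⟨vuc, hvuc, vs, hvs, rfl⟩ := Submodule.mem_sup.1 (htop ▸ Submodule.mem_top : v ∈ _)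
  obtain ⟨vu, hvu, vc, hvc, rfl⟩ := Submodule.mem_sup.1 hvuc
  obtain ⟨K1, hK1, h1⟩ := wronskian_sq_le_of_bounded_left hcd hq
    (isGeneralizedEigenfunction_orbitSeq T C V E ω vu) k w
    (bddAbove_orbitSeq_image T C V E ω (hph.bounded_unstable hvu) hleft)
  -- The center orbit is bounded in both directions; the right half-line is an arbitrary choice.
  obtain ⟨K2, hK2, h2⟩ := wronskian_sq_le_of_bounded_right hcd hq
    (isGeneralizedEigenfunction_orbitSeq T C V E ω vc) k w
    (bddAbove_orbitSeq_image T C V E ω (s := Ici 0) ⟨Mc * ‖vc‖, fun n _ =>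
      ContinuousLinearMap.le_of_opNorm_le
        ((act (cocycleIter T (schrodingerCocycle C V E) n ω)).comp (Ec ω).subtypeL)
        (hMc ⟨n, rfl⟩) ⟨vc, hvc⟩⟩ hright)
  obtain ⟨K3, hK3, h3⟩ := wronskian_sq_le_of_bounded_right hcd hq
    (isGeneralizedEigenfunction_orbitSeq T C V E ω vs) k w
    (bddAbove_orbitSeq_image T C V E ω (hph.bounded_stable hvs) hright)
  refine ⟨3 * (K1 + K2 + K3), by positivity, fun ε u hε hε1 hu => ?_⟩
  rw [orbitSeq_add, orbitSeq_add, wronskian_add, wronskian_add]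
  refine (pow_le_pow_left₀ (norm_nonneg _) (norm_add₃_le) 2).trans ?_
  have e1 := h1 ε u hε hε1 hu
  have e2 := h2 ε u hε hε1 hu
  have e3 := h3 ε u hε hε1 hu
  set a := ‖wronskian (act (C : Matrix (Fin m) (Fin m) ℂ)) (act (C : Matrix (Fin m) (Fin m) ℂ)ᴴ)
    (orbitSeq T C V E ω vu) u k‖
  set b := ‖wronskian (act (C : Matrix (Fin m) (Fin m) ℂ)) (act (C : Matrix (Fin m) (Fin m) ℂ)ᴴ)
    (orbitSeq T C V E ω vc) u k‖
  set c := ‖wronskian (act (C : Matrix (Fin m) (Fin m) ℂ)) (act (C : Matrix (Fin m) (Fin m) ℂ)ᴴ)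
    (orbitSeq T C V E ω vs) u k‖
  nlinarith [sq_nonneg (a - b), sq_nonneg (a - c), sq_nonneg (b - c)]

/-- The entry `u k` of a Green function is read off from its Wronskian at `k` with a suitable
generalized eigenfunction. -/
theorem exists_wronskian_eq_inner (k : ℤ) (w : EuclideanSpace ℂ (Fin m)) :
    ∃ v, ∀ u : ℤ → EuclideanSpace ℂ (Fin m),
      wronskian (act (C : Matrix (Fin m) (Fin m) ℂ)) (act (C : Matrix (Fin m) (Fin m) ℂ)ᴴ)
        (orbitSeq T C V E ω v) u k = inner ℂ w (u k) := by
  set M := (C : Matrix (Fin m) (Fin m) ℂ) with hM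
  have hC : IsUnit Mᴴ.det := by
    rw [Matrix.det_conjTranspose]
    exact ((Matrix.isUnit_iff_isUnit_det _).1 C.isUnit).star
  set P := cocycleIter T (schrodingerCocycle C V E) k ω with hP
  have hPu : IsUnit P.det := (Matrix.isUnit_iff_isUnit_det _).1
    (isUnit_cocycleIter (isUnit_schrodingerCocycle C V E) k ω)
  set y := act Mᴴ⁻¹ w with hy
  have hyw : act Mᴴ y = w := by
    rw [hy, act, act, ← mul_apply_eq_comp, ← map_mul, Matrix.mul_nonsing_inv _ hC, map_one]
    rfl
  -- Data at site `k`: `φ_k = 0` kills one term of the Wronskian, and `φ_{k-1} = y` with `C*y = w`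
  -- turns the other into `⟨w, u_k⟩`. Applying `P⁻¹` transports the data back to time `0`.
  set x : EuclideanSpace ℂ (Fin m ⊕ Fin m) := WithLp.toLp 2 (Sum.elim 0 y) with hx
  have hPx : act P (act P⁻¹ x) = x := by
    rw [act, act, ← mul_apply_eq_comp, ← map_mul, Matrix.mul_nonsing_inv _ hPu, map_one]
    rfl
  refine ⟨act P⁻¹ x, fun u => ?_⟩
  have h0 : upper x = 0 := by ext i; simp [upper, hx]
  have h1 : lower x = y := by ext i; simp [lower, hx]
  rw [wronskian, orbitSeq_sub_one, orbitSeq, ← hP, hPx, h0, h1, inner_zero_left, sub_zero]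
  conv_rhs => rw [← hyw, inner_toEuclideanCLM_conjTranspose, Matrix.conjTranspose_conjTranspose]

variable [CompactSpace Ω]

theorem isGreenFunction_of_resolvent {ε : ℝ} {k : ℤ} {w : EuclideanSpace ℂ (Fin m)}
    {u : StripSpace m}
    (hu : stripOperator T C V ω u - ((E : ℂ) + ε * Complex.I) • u = lp.single 2 k w) :
    IsGreenFunction (act (C : Matrix (Fin m) (Fin m) ℂ)) (act (C : Matrix (Fin m) (Fin m) ℂ)ᴴ)
      (fun n => act (V ((T ^ n) ω) : Matrix (Fin m) (Fin m) ℂ)) E ε k w u := by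
  intro n
  have h := congrArg (fun f : StripSpace m => f n) (sub_eq_iff_eq_add.1 hu)
  simp only [stripOperator_apply] at h
  refine h.trans ?_
  rw [lp.coeFn_add, Pi.add_apply, lp.coeFn_smul, Pi.smul_apply, add_smul, lp.coeFn_single]
  abel

/-- The estimate closes on itself: `g = ε‖u‖²` is the imaginary part of a Wronskian whose square
grows at most linearly in `g`. -/
theorem resolvent_bound_of_mem_centerBoundedEnergies (hE : E ∈ centerBoundedEnergies T C V ω)
    (k : ℤ) (w : EuclideanSpace ℂ (Fin m)) :
    ∃ b : ℝ, ∀ (ε : ℝ) (u : StripSpace m), 0 < ε → ε ≤ 1 →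
      stripOperator T C V ω u - ((E : ℂ) + ε * Complex.I) • u = lp.single 2 k w →
      ε * ‖u‖ ^ 2 ≤ b := by
  obtain ⟨v, hv⟩ := exists_wronskian_eq_inner T C V E ω k w
  obtain ⟨K, hK, h⟩ := wronskian_sq_le_of_mem_centerBoundedEnergies T C V E ω hE k w v
  -- If `g > 1 + 2K`, then `g² > g + 2Kg ≥ K(1 + g)`, contradicting the quadratic inequality.
  refine ⟨1 + 2 * K, fun ε u hε hε1 hu => ?_⟩
  have h1 := h ε u hε hε1 (isGreenFunction_of_resolvent T C V E ω hu)
  have him := im_inner_resolvent (isSelfAdjoint_stripOperator T C V ω) hu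
  rw [hv] at h1
  rw [lp.inner_single_left] at him
  set g := ε * ‖u‖ ^ 2 with hg
  have hg0 : 0 ≤ g := by positivity
  have hle : g ≤ ‖inner ℂ w (u k)‖ :=
    him ▸ (le_abs_self _).trans (Complex.abs_im_le_norm _)
  have hsq : g ^ 2 ≤ K * (1 + g) := (pow_le_pow_left₀ hg0 hle 2).trans h1
  by_contra! hlt
  nlinarith

/-- Sums alone suffice, without scalars, since the entry at each site ranges over all of `ℂᵐ`. -/
theorem dense_closure_range_single :
    Dense (AddSubmonoid.closure (range fun p : ℤ × EuclideanSpace ℂ (Fin m) =>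
      (lp.single 2 p.1 p.2 : StripSpace m)) : Set (StripSpace m)) := by
  intro f
  refine mem_closure_of_tendsto (lp.hasSum_single ENNReal.ofNat_ne_top f)
    (Eventually.of_forall fun s => ?_)
  exact AddSubmonoid.sum_mem _ fun i _ => AddSubmonoid.subset_closure ⟨(i, f i), rfl⟩

end Orbits

end StripSchrodinger

end

theorem mainTheorem1 {Ω : Type*} [MetricSpace Ω] [CompactSpace Ω] (T : Ω ≃ₜ Ω) (m : ℕ)
    (C : GL (Fin m) ℂ) (V : C(Ω, StripSchrodinger.Her m)) (ω : Ω) :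
    StripSchrodinger.IsPurelyAbsolutelyContinuousOn
      (StripSchrodinger.stripOperator T C V ω)
      (StripSchrodinger.isSelfAdjoint_stripOperator T C V ω)
      (StripSchrodinger.centerBoundedEnergies T C V ω) := by
  refine StripSchrodinger.isPurelyAbsolutelyContinuousOn_of_resolvent_bound _
    StripSchrodinger.dense_closure_range_single ?_
  rintro _ ⟨⟨k, w⟩, rfl⟩ E hE
  exact StripSchrodinger.resolvent_bound_of_mem_centerBoundedEnergies T C V E ω hE k w
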